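/- Let $k$ be an algebraically closed field and let $A$ be a basic finite-dimensional $k$-algebra, that is, the left module ${}_AA$ is a finite direct sum of pairwise non-isomorphic indecomposable modules. All modules are left $A$-modules. For a class $\mathcal X$ of modules, $\mathcal F(\mathcal X)$ denotes the class of modules $N$ that have a finite chain of submodules $0=N_0\subseteq N_1\subseteq\dots\subseteq N_n=N$ each of whose quotients $N_l/N_{l-1}$ is isomorphic to a module in $\mathcal X$. Let $t$ be a positive integer. An Ext-projective stratifying system of size $t$ is a triple $(\Theta,Q,\le)$, where $\Theta=\{\Theta(i)\}_{i=1}^t$ is a family of non-zero finitely generated modules, $Q=\{Q(i)\}_{i=1}^t$ is a family of indecomposable finitely generated modules, and $\le$ is the natural order on $\{1,\dots,t\}$, such that 1. $\mathrm{Hom}_A(\Theta(j),\Theta(i))=0$ for $j>i$; 2. for each $i$ there is an exact sequence $\eta_i:\ 0\to U(i)\xrightarrow{\alpha_i}Q(i)\xrightarrow{\beta_i}\Theta(i)\to 0$ of finitely generated modules with $U(i)\in\mathcal F(\{\Theta(j):j>i\})$; 3. $\mathrm{Ext}^1_A\big(\bigoplus_{i=1}^tQ(i),X\big)=0$ for every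 $X\in\mathcal F(\{\Theta(i)\}_{i=1}^t)$. Its Cartan matrix $C_\Theta\in\mathrm{Mat}_{t\times t}(\mathbb Z)$ has entries $[C_\Theta]_{i,j}=\dim_k\mathrm{Hom}_A(Q(i),\Theta(j))$. Given sequences $\eta_i$ as in 2., let $$\partial_{i,j}:\mathrm{Hom}_A(U(i),\Theta(j))\to\mathrm{Ext}^1_A(\Theta(i),\Theta(j))$$ be the $k$-linear map that sends $f$ to the class of the push-out of $\eta_i$ along $f$. **Proposition.** Let $(\Theta,Q,\le)$ be an Ext-projective stratifying system of size $t$, and for each $i$ let $\eta_i$ be any exact sequence as in 2. Then the following statements are equivalent. (a) The matrix $C_\Theta$ is diagonal. (b) $\mathrm{Hom}_A(Q(i),Q(j))=0$ for all $i<j$. (c) $\mathrm{Hom}_A(Q(i),\Theta(j))=0$ for all $i<j$. (d) For all $i<j$, $\mathrm{Hom}_A(\Theta(i),\Theta(j))=0$ and $\partial_{i,j}$ is an isomorphism. Moreover, if one of these conditions holds, then $\mathrm{Hom}_A(Q(i),U(j))=0$ for all $i<j$. -/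

import Mathlib

open CategoryTheory CategoryTheory.Limits CategoryTheory.Abelian

universe w v u

namespace Strat

section Modules

variable {A : Type u} [Ring A]

/-- `N` admits an `𝒳`-filtration: a finite chain `0 = F 0 ⊆ F 1 ⊆ ⋯ ⊆ F n = N` of submodules
whose successive quotients are isomorphic to members of `𝒳`. -/
def HasFiltration (𝒳 : Set (ModuleCat.{u} A)) (N : ModuleCat.{u} A) : Prop :=
  ∃ (n : ℕ) (F : Fin (n + 1) → Submodule A N),
    Monotone F ∧ F 0 = ⊥ ∧ F (Fin.last n) = ⊤ ∧
      ∀ i : Fin n, ∃ X ∈ 𝒳,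
        Nonempty ((F i.succ ⧸ (F i.castSucc).submoduleOf (F i.succ)) ≃ₗ[A] X)

/-- A module is basic if it is a finite direct sum of pairwise non-isomorphic
indecomposable modules. -/
def IsBasicModule (M : ModuleCat.{u} A) : Prop :=
  ∃ (n : ℕ) (N : Fin n → ModuleCat.{u} A),
    (∀ i, Indecomposable (N i)) ∧ (∀ i j, i ≠ j → IsEmpty (N i ≅ N j)) ∧
      Nonempty (M ≅ ⨁ N)

/-- An exact sequence `0 ⟶ U ⟶ Q i ⟶ Θ i ⟶ 0` of finitely generated modules in which `U` is
filtered by `{Θ j : j > i}`. -/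
structure PresentingSequence {t : ℕ} (Θ Q : Fin t → ModuleCat.{u} A) (i : Fin t) where
  U : ModuleCat.{u} A
  α : U ⟶ Q i
  β : Q i ⟶ Θ i
  zero : α ≫ β = 0
  finite : Module.Finite A U
  shortExact : (ShortComplex.mk α β zero).ShortExact
  filtered : HasFiltration (Θ '' Set.Ioi i) U

/-- `(Θ, Q, ≤)` is an Ext-projective stratifying system of size `t` in the category of finitely
generated `A`-modules; `≤` is the natural order of `Fin t`. -/
structure IsExtProjectiveStratifyingSystem {t : ℕ} (Θ Q : Fin t → ModuleCat.{u} A) : Prop where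
  finite_Θ : ∀ i, Module.Finite A (Θ i)
  finite_Q : ∀ i, Module.Finite A (Q i)
  nonzero : ∀ i, ¬ IsZero (Θ i)
  indecomposable : ∀ i, Indecomposable (Q i)
  hom_eq_zero : ∀ i j, i < j → ∀ f : Θ j ⟶ Θ i, f = 0
  exists_sequence : ∀ i, Nonempty (PresentingSequence Θ Q i)
  ext_eq_zero : ∀ X : ModuleCat.{u} A, HasFiltration (Set.range Θ) X →
    ∀ x : Ext.{u} (⨁ Q) X 1, x = 0

/-- The Cartan matrix of the system, with `(i, j)` entry `dim_k Hom_A(Q i, Θ j)`. -/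
noncomputable def cartanMatrix (k : Type w) [Field k] [Algebra k A] {t : ℕ}
    (Θ Q : Fin t → ModuleCat.{u} A) : Matrix (Fin t) (Fin t) ℤ :=
  Matrix.of fun i j => (Module.finrank k (Q i ⟶ Θ j) : ℤ)

end Modules

section Pushout

variable {C : Type u} [Category.{v} C] [Abelian C] {U Q T Y : C}

/-- The map `Q ⊔_U Y ⟶ T` out of the push-out of `α : U ⟶ Q` and `f : U ⟶ Y` which is
`β : Q ⟶ T` on `Q` and zero on `Y`. -/
noncomputable def pushoutProj (α : U ⟶ Q) (β : Q ⟶ T) (w : α ≫ β = 0) (f : U ⟶ Y) :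
    pushout α f ⟶ T :=
  pushout.desc β (0 : Y ⟶ T) (by rw [w, comp_zero])

theorem inl_pushoutProj (α : U ⟶ Q) (β : Q ⟶ T) (w : α ≫ β = 0) (f : U ⟶ Y) :
    pushout.inl α f ≫ pushoutProj α β w f = β :=
  pushout.inl_desc _ _ _

theorem inr_pushoutProj (α : U ⟶ Q) (β : Q ⟶ T) (w : α ≫ β = 0) (f : U ⟶ Y) :
    pushout.inr α f ≫ pushoutProj α β w f = 0 :=
  pushout.inr_desc _ _ _

/-- The push-out along `f : U ⟶ Y` of a short exact sequence `0 ⟶ U ⟶ Q ⟶ T ⟶ 0` is the short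
exact sequence `0 ⟶ Y ⟶ Q ⊔_U Y ⟶ T ⟶ 0`. -/
theorem pushout_shortExact {α : U ⟶ Q} {β : Q ⟶ T} {w : α ≫ β = 0}
    (hS : (ShortComplex.mk α β w).ShortExact) (f : U ⟶ Y) :
    (ShortComplex.mk (pushout.inr α f) (pushoutProj α β w f)
      (inr_pushoutProj α β w f)).ShortExact := by
  have hα : Mono α := hS.mono_f
  have hβ : Epi β := hS.epi_g
  have hm : Mono (pushout.inr α f) := inferInstance
  have he : Epi (pushoutProj α β w f) := by
    have : Epi (pushout.inl α f ≫ pushoutProj α β w f) := by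
      rw [inl_pushoutProj]; exact hβ
    exact epi_of_epi (pushout.inl α f) _
  refine ShortComplex.ShortExact.mk' ?_ hm he
  apply ShortComplex.exact_of_g_is_cokernel
  refine CokernelCofork.IsColimit.ofπ' _ _ fun {Z} (g : pushout α f ⟶ Z) hg => ?_
  have hg' : pushout.inr α f ≫ g = 0 := hg
  have h0 : α ≫ pushout.inl α f ≫ g = 0 := by
    rw [pushout.condition_assoc, hg', comp_zero]
  have hd : β ≫ hS.exact.desc (pushout.inl α f ≫ g) h0 = pushout.inl α f ≫ g :=
    hS.exact.g_desc _ _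
  refine ⟨hS.exact.desc (pushout.inl α f ≫ g) h0, ?_⟩
  change pushoutProj α β w f ≫ hS.exact.desc (pushout.inl α f ≫ g) h0 = g
  apply pushout.hom_ext
  · rw [← Category.assoc, inl_pushoutProj, hd]
  · rw [← Category.assoc, inr_pushoutProj, zero_comp, hg']

variable [HasExt.{w} C]

/-- The class in `Ext¹(T, Y)` of the push-out along `f : U ⟶ Y` of the short exact sequence
`0 ⟶ U ⟶ Q ⟶ T ⟶ 0`. -/
noncomputable def pushoutClass {α : U ⟶ Q} {β : Q ⟶ T} {w : α ≫ β = 0}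
    (hS : (ShortComplex.mk α β w).ShortExact) (f : U ⟶ Y) : Ext.{w} T Y 1 :=
  (pushout_shortExact hS f).extClass

theorem pushoutClass_eq {α : U ⟶ Q} {β : Q ⟶ T} {w : α ≫ β = 0}
    (hS : (ShortComplex.mk α β w).ShortExact) (f : U ⟶ Y) :
    pushoutClass.{w} hS f =
      Ext.comp (X := T) (Y := U) (Z := Y) hS.extClass (Ext.mk₀ f) (add_zero 1) := by
  have h := ShortComplex.ShortExact.extClass_naturality.{w} hS (pushout_shortExact hS f)
    { τ₁ := f
      τ₂ := pushout.inl α f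
      τ₃ := 𝟙 T
      comm₁₂ := pushout.condition.symm
      comm₂₃ := (inl_pushoutProj α β w f).trans (Category.comp_id β).symm }
  exact (h.trans (Ext.mk₀_id_comp (pushoutClass.{w} hS f))).symm

end Pushout

section Connecting

variable {A : Type u} [Ring A]

/-- The `k`-linear map `∂ : Hom(U, Y) → Ext¹(Θ i, Y)` sending `f` to the class of the push-out
of the sequence `0 ⟶ U ⟶ Q i ⟶ Θ i ⟶ 0` along `f`. -/
noncomputable def connectingMap (k : Type w) [Field k] [Algebra k A] {t : ℕ}
    {Θ Q : Fin t → ModuleCat.{u} A} {i : Fin t} (η : PresentingSequence Θ Q i)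
    (Y : ModuleCat.{u} A) : (η.U ⟶ Y) →ₗ[k] Ext.{u} (Θ i) Y 1 where
  toFun f := pushoutClass.{u} η.shortExact f
  map_add' f g := by
    rw [pushoutClass_eq, pushoutClass_eq, pushoutClass_eq, Ext.mk₀_add, Ext.comp_add]
  map_smul' r f := by
    rw [pushoutClass_eq, pushoutClass_eq, Ext.mk₀_smul, Ext.comp_smul, RingHom.id_apply]

end Connecting

end Strat

/-!
All four conditions are read off from the sequences `0 ⟶ U i ⟶ Q i ⟶ Θ i ⟶ 0`. Vanishing of `Hom`
into, or out of, every factor of a filtration passes to the filtered module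
(`HasFiltration.eq_zero_of_source`, `HasFiltration.eq_zero_of_target`).

For `j < i` both `Hom(Θ i, Θ j)` and `Hom(U i, Θ j)` vanish, hence so does `Hom(Q i, Θ j)`: the
Cartan matrix is always upper triangular, and it is diagonal exactly when `Hom(Q i, Θ j) = 0` for
all `i < j` (the `Hom` spaces being finite-dimensional). In that case `Hom(Q i, U j) = 0` because
`U j` is filtered by the `Θ l` with `l > j > i`, and `Hom(Q i, Q j) = 0` by left exactness.
Conversely, `Ext¹(Q i, U j) = 0` lets every `Q i ⟶ Θ j` lift to `Q i ⟶ Q j`.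

The condition on the connecting maps comes from the exact sequence
`0 → Hom(Θ i, Θ j) → Hom(Q i, Θ j) → Hom(U i, Θ j) → Ext¹(Θ i, Θ j) → Ext¹(Q i, Θ j) = 0`,
in which taking push-outs is the connecting map `Hom(U i, Θ j) → Ext¹(Θ i, Θ j)`.
-/

namespace Strat

/-! ### Vanishing of morphisms on filtered modules -/

section Filtrations

variable {A : Type u} [Ring A] {𝒳 𝒴 : Set (ModuleCat.{u} A)} {N : ModuleCat.{u} A}

theorem HasFiltration.mono (hN : HasFiltration 𝒳 N) (h : 𝒳 ⊆ 𝒴) : HasFiltration 𝒴 N := by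
  obtain ⟨n, F, hF, h0, hn, hq⟩ := hN
  refine ⟨n, F, hF, h0, hn, fun i => ?_⟩
  obtain ⟨X, hX, e⟩ := hq i
  exact ⟨X, h hX, e⟩

theorem HasFiltration.of_mem (hN : N ∈ 𝒳) : HasFiltration 𝒳 N := by
  refine ⟨1, ![⊥, ⊤], ?_, rfl, rfl, fun i => ⟨N, hN, ?_⟩⟩
  · intro a b hab
    fin_cases a <;> fin_cases b <;> simp_all
  · fin_cases i
    have h : (⊥ : Submodule A N).submoduleOf ⊤ = ⊥ := by
      simp [Submodule.submoduleOf]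
    exact ⟨(Submodule.quotEquivOfEqBot _ h).trans Submodule.topEquiv⟩

/-- If `Hom(M, X) = 0` for every `X ∈ 𝒳`, then `Hom(M, N) = 0` for every `𝒳`-filtered `N`: the
image of a morphism is pushed down the chain one step at a time. -/
theorem HasFiltration.eq_zero_of_source (hN : HasFiltration 𝒳 N) {M : ModuleCat.{u} A}
    (hM : ∀ X ∈ 𝒳, ∀ f : M ⟶ X, f = 0) (f : M ⟶ N) : f = 0 := by
  obtain ⟨n, F, -, h0, hn, hq⟩ := hN
  have key : ∀ i, ∀ m : M, f.hom m ∈ F i := by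
    intro i
    induction i using Fin.reverseInduction with
    | last => simp [hn]
    | cast i ih =>
      obtain ⟨X, hX, ⟨e⟩⟩ := hq i
      intro m
      have hg := hM X hX (ModuleCat.ofHom (e.toLinearMap ∘ₗ Submodule.mkQ _ ∘ₗ
        LinearMap.codRestrict (F i.succ) f.hom ih))
      have hgm := LinearMap.congr_fun (congrArg ModuleCat.Hom.hom hg) m
      have hz : Submodule.Quotient.mk (p := (F i.castSucc).submoduleOf (F i.succ))
          ⟨f.hom m, ih m⟩ = 0 := e.map_eq_zero_iff.mp hgm
      have hmem := (Submodule.Quotient.mk_eq_zero _).mp hz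
      exact hmem
  ext m
  have hm := key 0 m
  rw [h0, Submodule.mem_bot] at hm
  exact hm

/-- If `Hom(X, Y) = 0` for every `X ∈ 𝒳`, then `Hom(N, Y) = 0` for every `𝒳`-filtered `N`: the
kernel of a morphism climbs the chain one step at a time. -/
theorem HasFiltration.eq_zero_of_target (hN : HasFiltration 𝒳 N) {Y : ModuleCat.{u} A}
    (hY : ∀ X ∈ 𝒳, ∀ f : X ⟶ Y, f = 0) (f : N ⟶ Y) : f = 0 := by
  obtain ⟨n, F, -, h0, hn, hq⟩ := hN
  have key : ∀ i, ∀ m ∈ F i, f.hom m = 0 := by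
    intro i
    induction i using Fin.induction with
    | zero =>
      intro m hm
      rw [h0, Submodule.mem_bot] at hm
      rw [hm, map_zero]
    | succ i ih =>
      obtain ⟨X, hX, ⟨e⟩⟩ := hq i
      intro m hm
      have hle : (F i.castSucc).submoduleOf (F i.succ) ≤
          LinearMap.ker (f.hom ∘ₗ (F i.succ).subtype) := fun x hx => ih x hx
      have hg := hY X hX (ModuleCat.ofHom
        (Submodule.liftQ _ (f.hom ∘ₗ (F i.succ).subtype) hle ∘ₗ e.symm.toLinearMap))
      have hgm := LinearMap.congr_fun (congrArg ModuleCat.Hom.hom hg)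
        (e (Submodule.Quotient.mk ⟨m, hm⟩))
      simpa using hgm
  ext m
  exact key (Fin.last n) m (by rw [hn]; trivial)

end Filtrations

/-! ### Finite-dimensionality of morphism spaces -/

section FiniteDimensionality

open scoped ModuleCat.Algebra in
/-- Over a finite-dimensional algebra, morphisms between finitely generated modules form a
finite-dimensional space, so that its `finrank` vanishes only if the space does. -/
theorem finiteDimensional_hom (k : Type w) [Field k] {A : Type u} [Ring A] [Algebra k A]
    [FiniteDimensional k A] (M N : ModuleCat.{u} A) [Module.Finite A M] [Module.Finite A N] :
    FiniteDimensional k (M ⟶ N) := by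
  have : FiniteDimensional k M := Module.Finite.trans A M
  have : FiniteDimensional k N := Module.Finite.trans A N
  let φ : (M ⟶ N) →ₗ[k] (M →ₗ[k] N) :=
    { toFun := fun f => f.hom.restrictScalars k
      map_add' := fun _ _ => rfl
      map_smul' := fun _ _ => rfl }
  refine FiniteDimensional.of_injective φ fun f g hfg => ?_
  ext m
  exact LinearMap.congr_fun hfg m

end FiniteDimensionality

/-! ### The connecting map by push-out -/

section Connecting

variable {A : Type u} [Ring A] (k : Type w) [Field k] [Algebra k A] {t : ℕ}
  {Θ Q : Fin t → ModuleCat.{u} A} {i : Fin t} (η : PresentingSequence Θ Q i)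
  {Y : ModuleCat.{u} A}

theorem connectingMap_apply (f : η.U ⟶ Y) :
    connectingMap k η Y f =
      Ext.comp (X := Θ i) (Y := η.U) (Z := Y) η.shortExact.extClass (Ext.mk₀ f) (add_zero 1) :=
  pushoutClass_eq η.shortExact f

theorem connectingMap_eq_zero_iff (f : η.U ⟶ Y) :
    connectingMap k η Y f = 0 ↔ ∃ g : Q i ⟶ Y, η.α ≫ g = f := by
  rw [connectingMap_apply]
  constructor
  · intro hf
    obtain ⟨x, hx⟩ := Ext.contravariant_sequence_exact₁ η.shortExact Y (Ext.mk₀ f)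
      (add_zero 1) hf
    obtain ⟨g, rfl⟩ := (Ext.mk₀_bijective (Q i) Y).2 x
    refine ⟨g, (Ext.mk₀_bijective η.U Y).1 ?_⟩
    rw [← hx]
    exact (Ext.mk₀_comp_mk₀ η.α g).symm
  · rintro ⟨g, rfl⟩
    rw [← Ext.mk₀_comp_mk₀]
    exact η.shortExact.extClass_comp_assoc (Ext.mk₀ g) (h := add_zero 1)

theorem connectingMap_surjective (hY : ∀ x : Ext.{u} (Q i) Y 1, x = 0) :
    Function.Surjective (connectingMap k η Y) := by
  intro x
  obtain ⟨y, hy⟩ := Ext.contravariant_sequence_exact₃ η.shortExact Y x (hY _) (add_zero 1)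
  obtain ⟨f, rfl⟩ := (Ext.mk₀_bijective η.U Y).2 y
  exact ⟨f, (connectingMap_apply k η f).trans hy⟩

end Connecting

/-! ### Ext-projective stratifying systems -/

section StratifyingSystems

variable {A : Type u} [Ring A] {t : ℕ} {Θ Q : Fin t → ModuleCat.{u} A}

theorem PresentingSequence.filtered_range {i : Fin t} (η : PresentingSequence Θ Q i) :
    HasFiltration (Set.range Θ) η.U :=
  η.filtered.mono (Set.image_subset_range _ _)

theorem PresentingSequence.eq_zero_of_source {j : Fin t} (η : PresentingSequence Θ Q j)
    {M : ModuleCat.{u} A} (hM : ∀ l, j < l → ∀ f : M ⟶ Θ l, f = 0) (f : M ⟶ η.U) : f = 0 :=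
  η.filtered.eq_zero_of_source (by rintro _ ⟨l, hl, rfl⟩; exact hM l hl) f

/-- A morphism out of `Q i` that vanishes on `U i` factors through `Θ i`. -/
theorem PresentingSequence.exists_desc {i : Fin t} (η : PresentingSequence Θ Q i)
    {Y : ModuleCat.{u} A} (f : Q i ⟶ Y) (hf : η.α ≫ f = 0) : ∃ g : Θ i ⟶ Y, η.β ≫ g = f :=
  have := η.shortExact.epi_g
  ⟨η.shortExact.exact.desc f hf, η.shortExact.exact.g_desc f hf⟩

/-- A morphism into `Q j` that vanishes in `Θ j` factors through `U j`. -/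
theorem PresentingSequence.exists_lift {j : Fin t} (η : PresentingSequence Θ Q j)
    {M : ModuleCat.{u} A} (f : M ⟶ Q j) (hf : f ≫ η.β = 0) : ∃ g : M ⟶ η.U, g ≫ η.α = f :=
  have := η.shortExact.mono_f
  ⟨η.shortExact.exact.lift f hf, η.shortExact.exact.lift_f f hf⟩

theorem IsExtProjectiveStratifyingSystem.ext_component_eq_zero
    (h : IsExtProjectiveStratifyingSystem Θ Q) (i : Fin t) {X : ModuleCat.{u} A}
    (hX : HasFiltration (Set.range Θ) X) (x : Ext.{u} (Q i) X 1) : x = 0 := by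
  have hx := h.ext_eq_zero X hX ((Ext.mk₀ (biproduct.π Q i)).comp x (zero_add 1))
  have hι := congrArg (fun y => (Ext.mk₀ (biproduct.ι Q i)).comp y (zero_add 1)) hx
  simpa using hι

/-- The Cartan matrix is upper triangular. -/
theorem IsExtProjectiveStratifyingSystem.hom_eq_zero_of_lt
    (h : IsExtProjectiveStratifyingSystem Θ Q) {i j : Fin t} (hji : j < i) (f : Q i ⟶ Θ j) :
    f = 0 := by
  obtain ⟨η⟩ := h.exists_sequence i
  have hf : η.α ≫ f = 0 := η.filtered.eq_zero_of_target
    (by rintro _ ⟨l, hl, rfl⟩; exact h.hom_eq_zero j l (hji.trans hl)) _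
  obtain ⟨g, rfl⟩ := η.exists_desc f hf
  rw [h.hom_eq_zero j i hji g, comp_zero]

theorem IsExtProjectiveStratifyingSystem.cartanMatrix_apply_eq_zero_iff (k : Type w) [Field k]
    [Algebra k A] [FiniteDimensional k A] (h : IsExtProjectiveStratifyingSystem Θ Q)
    (i j : Fin t) : cartanMatrix k Θ Q i j = 0 ↔ ∀ f : Q i ⟶ Θ j, f = 0 := by
  have := h.finite_Q i
  have := h.finite_Θ j
  have := finiteDimensional_hom k (Q i) (Θ j)
  rw [cartanMatrix, Matrix.of_apply, Nat.cast_eq_zero, Module.finrank_zero_iff,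
    subsingleton_iff_forall_eq 0]

theorem IsExtProjectiveStratifyingSystem.cartanMatrix_isDiag_iff (k : Type w) [Field k]
    [Algebra k A] [FiniteDimensional k A] (h : IsExtProjectiveStratifyingSystem Θ Q) :
    (cartanMatrix k Θ Q).IsDiag ↔ ∀ i j, i < j → ∀ f : Q i ⟶ Θ j, f = 0 := by
  constructor
  · exact fun hd i j hij => (h.cartanMatrix_apply_eq_zero_iff k i j).mp (hd hij.ne)
  · intro hc i j hij
    refine (h.cartanMatrix_apply_eq_zero_iff k i j).mpr ?_
    rcases hij.lt_or_gt with hlt | hgt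
    · exact hc i j hlt
    · exact h.hom_eq_zero_of_lt hgt

/-- Since `Ext¹(Q i, U j) = 0`, every morphism `Q i ⟶ Θ j` lifts to `Q i ⟶ Q j`. -/
theorem IsExtProjectiveStratifyingSystem.exists_lift (h : IsExtProjectiveStratifyingSystem Θ Q)
    {i j : Fin t} (η : PresentingSequence Θ Q j) (f : Q i ⟶ Θ j) :
    ∃ g : Q i ⟶ Q j, g ≫ η.β = f := by
  obtain ⟨x, hx⟩ := Ext.covariant_sequence_exact₃ (Q i) η.shortExact (Ext.mk₀ f) (zero_add 1)
    (h.ext_component_eq_zero i η.filtered_range _)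
  obtain ⟨g, rfl⟩ := (Ext.mk₀_bijective (Q i) (Q j)).2 x
  refine ⟨g, (Ext.mk₀_bijective (Q i) (Θ j)).1 ?_⟩
  rw [← hx]
  exact (Ext.mk₀_comp_mk₀ g η.β).symm

/-- The exact sequence `0 → Hom(Θ i, Y) → Hom(Q i, Y) → Hom(U i, Y) → Ext¹(Θ i, Y) → 0` for a
`Θ`-filtered `Y`: its second term vanishes exactly when its first does and the last map is
bijective. -/
theorem IsExtProjectiveStratifyingSystem.hom_eq_zero_iff_connectingMap_bijective (k : Type w)
    [Field k] [Algebra k A] (h : IsExtProjectiveStratifyingSystem Θ Q) {i : Fin t}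
    (η : PresentingSequence Θ Q i) {Y : ModuleCat.{u} A} (hY : HasFiltration (Set.range Θ) Y) :
    (∀ f : Q i ⟶ Y, f = 0) ↔
      (∀ f : Θ i ⟶ Y, f = 0) ∧ Function.Bijective (connectingMap k η Y) := by
  constructor
  · intro hQ
    have := η.shortExact.epi_g
    refine ⟨fun f => ?_, ?_, connectingMap_surjective k η (h.ext_component_eq_zero i hY)⟩
    · exact (cancel_epi η.β).mp ((hQ (η.β ≫ f)).trans comp_zero.symm)
    · refine (injective_iff_map_eq_zero _).mpr fun f hf => ?_
      obtain ⟨g, rfl⟩ := (connectingMap_eq_zero_iff k η f).mp hf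
      rw [hQ g, comp_zero]
  · rintro ⟨hΘ, hinj, -⟩ f
    have hf : η.α ≫ f = 0 := (injective_iff_map_eq_zero _).mp hinj _
      ((connectingMap_eq_zero_iff k η _).mpr ⟨f, rfl⟩)
    obtain ⟨g, rfl⟩ := η.exists_desc f hf
    rw [hΘ g, comp_zero]

end StratifyingSystems

end Strat

theorem proposition3p5 {k : Type w} [Field k] [IsAlgClosed k]
    {A : Type u} [Ring A] [Algebra k A] [FiniteDimensional k A]
    (hA : Strat.IsBasicModule (ModuleCat.of A A))
    {t : ℕ} {Θ Q : Fin t → ModuleCat.{u} A}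
    (h : Strat.IsExtProjectiveStratifyingSystem Θ Q)
    (η : ∀ i, Strat.PresentingSequence Θ Q i) :
    List.TFAE [
      (Strat.cartanMatrix k Θ Q).IsDiag,
      ∀ i j, i < j → ∀ f : Q i ⟶ Q j, f = 0,
      ∀ i j, i < j → ∀ f : Q i ⟶ Θ j, f = 0,
      ∀ i j, i < j → (∀ f : Θ i ⟶ Θ j, f = 0) ∧
        Function.Bijective (Strat.connectingMap k (η i) (Θ j))] ∧
    ((Strat.cartanMatrix k Θ Q).IsDiag →
      ∀ i j, i < j → ∀ f : Q i ⟶ (η j).U, f = 0) := by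
  have hU (hc : ∀ i j, i < j → ∀ f : Q i ⟶ Θ j, f = 0) (i j : Fin t) (hij : i < j)
      (f : Q i ⟶ (η j).U) : f = 0 :=
    (η j).eq_zero_of_source (fun l hl => hc i l (hij.trans hl)) f
  refine ⟨?_, fun ha => hU ((h.cartanMatrix_isDiag_iff k).mp ha)⟩
  tfae_have 1 ↔ 3 := h.cartanMatrix_isDiag_iff k
  tfae_have 2 → 3 := by
    intro hb i j hij f
    obtain ⟨g, rfl⟩ := h.exists_lift (η j) f
    rw [hb i j hij g, zero_comp]
  tfae_have 3 → 2 := by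
    intro hc i j hij f
    obtain ⟨g, rfl⟩ := (η j).exists_lift f (hc i j hij _)
    rw [hU hc i j hij g, zero_comp]
  tfae_have 3 ↔ 4 := forall₃_congr fun i j _ =>
    h.hom_eq_zero_iff_connectingMap_bijective k (η i) (.of_mem ⟨j, rfl⟩)
  tfae_finish
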